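/- Let $I_{11}, I_{22}, I_{33}, I_{23}$ be real numbers such that the symmetric matrix (the inertia tensor) $$\begin{pmatrix} I_{11} & 0 & 0\\ 0 & I_{22} & I_{23}\\ 0 & I_{23} & I_{33}\end{pmatrix}$$ is positive definite, and let its eigenvalues be denoted by $$J_1=I_{11},\qquad J_{2}=\tfrac12(I_{22}+I_{33})+\tfrac12\sqrt{(I_{22}-I_{33})^2+4I_{23}^2},\qquad J_{3}=\tfrac12(I_{22}+I_{33})-\tfrac12\sqrt{(I_{22}-I_{33})^2+4I_{23}^2}.$$ Consider, for complex time $\tau$ and complex unknowns $\omega_1,\omega_2$, the reduced inhomogeneous Suslov system $$J_1\,\omega_1' = -I_{23}\,\omega_2^2+\omega_2\,(I_{22}-I_{33})+I_{23},\qquad I_{22}\,\omega_2'=\omega_1\bigl(I_{23}\,\omega_2+(I_{33}-J_1)\bigr).$$ A solution $(\omega_1,\omega_2)$, holomorphic near a point $\tau_0\in\mathbb C$, is called single valued if its analytic continuations along any two paths in $\mathbb C$ from $\tau_0$ to a common end point, whenever they exist, yield the same germ at that end point. Then all solutions of the system are single valued if and only if either $I_{23}=0$, or $J_1=J_2$,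 or $J_1=J_3$. -/

import Mathlib

open Filter Topology

namespace Suslov

/-- The inertia tensor of the body, in a body frame in which the constraint vector is
`(0, 0, 1)` and `I₁₂ = I₁₃ = 0`. -/
def inertiaTensor (I₁₁ I₂₂ I₃₃ I₂₃ : ℝ) : Matrix (Fin 3) (Fin 3) ℝ :=
  !![I₁₁, 0, 0;
     0, I₂₂, I₂₃;
     0, I₂₃, I₃₃]

/-- The principal moment of inertia `J₁`. -/
def J₁ (I₁₁ : ℝ) : ℝ := I₁₁

/-- The principal moment of inertia `J₂` (the larger one of the lower block). -/
noncomputable def J₂ (I₂₂ I₃₃ I₂₃ : ℝ) : ℝ :=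
  1 / 2 * (I₂₂ + I₃₃) + 1 / 2 * Real.sqrt ((I₂₂ - I₃₃) ^ 2 + 4 * I₂₃ ^ 2)

/-- The principal moment of inertia `J₃` (the smaller one of the lower block). -/
noncomputable def J₃ (I₂₂ I₃₃ I₂₃ : ℝ) : ℝ :=
  1 / 2 * (I₂₂ + I₃₃) - 1 / 2 * Real.sqrt ((I₂₂ - I₃₃) ^ 2 + 4 * I₂₃ ^ 2)

/-- `ω = (ω₁, ω₂)` is a (holomorphic) solution, in a neighbourhood of the complex time `z₀`,
of the reduced inhomogeneous Suslov system with `I₁₃ = 0`: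
`J₁ ω₁' = -I₂₃ ω₂² + ω₂ (I₂₂ - I₃₃) + I₂₃`, `I₂₂ ω₂' = ω₁ (I₂₃ ω₂ + (I₃₃ - J₁))`. -/
def IsSolutionNear (I₁₁ I₂₂ I₃₃ I₂₃ : ℝ) (ω : ℂ → ℂ × ℂ) (z₀ : ℂ) : Prop :=
  ∀ᶠ z in 𝓝 z₀, DifferentiableAt ℂ ω z ∧
    (J₁ I₁₁ : ℂ) * (deriv ω z).1 =
      -(I₂₃ : ℂ) * (ω z).2 ^ 2 + (ω z).2 * ((I₂₂ : ℂ) - (I₃₃ : ℂ)) + (I₂₃ : ℂ) ∧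
    (I₂₂ : ℂ) * (deriv ω z).2 =
      (ω z).1 * ((I₂₃ : ℂ) * (ω z).2 + ((I₃₃ : ℂ) - (J₁ I₁₁ : ℂ)))

/-- `F` is an analytic continuation along the path `γ` of the germ of `f` at the starting point
of `γ`: each `F t` is analytic at `γ t`, `F 0` has the same germ as `f`, and for `s` close to `t`
the functions `F s` and `F t` have the same germ at `γ s`. -/
structure IsAnalyticContinuationAlong {z₀ z₁ : ℂ} (f : ℂ → ℂ × ℂ) (γ : Path z₀ z₁)
    (F : unitInterval → ℂ → ℂ × ℂ) : Prop where
  analyticAt : ∀ t, AnalyticAt ℂ (F t) (γ t)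
  start : F 0 =ᶠ[𝓝 z₀] f
  compatible : ∀ t, ∀ᶠ s in 𝓝 t, F s =ᶠ[𝓝 (γ s)] F t

/-- The (complete) analytic function generated by the germ of `f` at `z₀` is single valued:
analytic continuations of the germ along any two paths in the complex plane from `z₀` to the
same end point, whenever they exist, give the same germ at the end point. -/
def IsSingleValued (f : ℂ → ℂ × ℂ) (z₀ : ℂ) : Prop :=
  ∀ (z₁ : ℂ) (γ γ' : Path z₀ z₁) (F F' : unitInterval → ℂ → ℂ × ℂ),
    IsAnalyticContinuationAlong f γ F → IsAnalyticContinuationAlong f γ' F' →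
      F 1 =ᶠ[𝓝 z₁] F' 1

end Suslov

/-! Write `a, b, c, d` for `I₁₁, I₂₂, I₃₃, I₂₃` and `m = d² - (b - a)(c - a)`. For `d ≠ 0` the shift
`u = ω₂ + (c - a)/d` gives `u' = (d/b) ω₁ u` and an energy integral whose only multivalued term is
`(2m/d²) log u`; `m = 0` says exactly that `J₁` is `J₂` or `J₃`.

If `d = 0` the system is linear. If `m = 0`, the energy makes `(1/u, ω₁/u, 1)` satisfy a linear
system when `u ≠ 0`, so solutions are quotients of entire functions, hence single valued
(`isSingleValued_of_smul_eq`).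

If `d` and `m` are nonzero, put `u = exp(-ζ)/ε` and use `ζ` as parameter. On a suitable energy
level, time is `Z(ζ) ≈ -(ε/κ) exp ζ` up to a constant for small `ε`, so `Z` takes equal values at
two distinct points (`exists_ne_eq_of_deriv_near_exp`). The logarithm makes the solution differ
there (`eq_of_radicand_eq`), so continuation along a loop in time changes the germ
(`not_isSingleValued_comp_inverse`). -/

namespace Suslov

/-! ### Analytic continuation of quotients of entire functions -/

/-- Permanence of an analytic relation `V • f = W` under analytic continuation along a path. -/
theorem IsAnalyticContinuationAlong.eventually_smul_eq {z₀ z₁ : ℂ} {f : ℂ → ℂ × ℂ}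
    {γ : Path z₀ z₁} {F : unitInterval → ℂ → ℂ × ℂ} (hF : IsAnalyticContinuationAlong f γ F)
    {V : ℂ → ℂ} {W : ℂ → ℂ × ℂ} (hV : Differentiable ℂ V) (hW : Differentiable ℂ W)
    (h : ∀ᶠ z in 𝓝 z₀, V z • f z = W z) (t : unitInterval) :
    ∀ᶠ z in 𝓝 (γ t), V z • F t z = W z := by
  have hVa : ∀ z, AnalyticAt ℂ V z := fun z => hV.analyticAt z
  have hWa : ∀ z, AnalyticAt ℂ W z := fun z => hW.analyticAt z
  -- The parameters where the relation holds form a clopen set; closedness is the identity theorem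
  -- on a disc.
  set A : Set unitInterval := {t | ∀ᶠ z in 𝓝 (γ t), V z • F t z = W z} with hA
  have hcont : ∀ t, Tendsto γ (𝓝 t) (𝓝 (γ t)) := fun t => γ.continuous.continuousAt
  have hopen : IsOpen A := by
    rw [isOpen_iff_mem_nhds]
    intro t ht
    filter_upwards [hF.compatible t, (hcont t).eventually ht.eventually_nhds] with s hs hs'
    filter_upwards [hs, hs'] with z hz hz'
    rw [hz, hz']
  have hclosed : IsClosed A := by
    rw [isClosed_iff_frequently]
    intro t ht
    obtain ⟨r, hr, hball⟩ := Metric.eventually_nhds_iff_ball.1 (hF.analyticAt t).eventually_analyticAt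
    have hmem : ∀ᶠ s in 𝓝 t, γ s ∈ Metric.ball (γ t) r :=
      (hcont t).eventually (Metric.ball_mem_nhds _ hr)
    obtain ⟨s, hs, hs₁, hs₂⟩ := (ht.and_eventually (hmem.and (hF.compatible t))).exists
    have heq : Set.EqOn (fun z => V z • F t z) W (Metric.ball (γ t) r) := by
      refine AnalyticOnNhd.eqOn_of_preconnected_of_eventuallyEq
        (fun z hz => (hVa z).smul (hball z hz)) (fun z _ => hWa z)
        (convex_ball _ _).isPreconnected hs₁ ?_
      filter_upwards [hs, hs₂] with z hz hz'
      rw [← hz', hz]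
    filter_upwards [Metric.ball_mem_nhds _ hr] with z hz using heq hz
  have h0 : (0 : unitInterval) ∈ A := by
    simp only [hA, Set.mem_ofPred_eq, γ.source]
    filter_upwards [h, hF.start] with z hz hz'
    rw [hz', hz]
  have : A = Set.univ := IsClopen.eq_univ ⟨hclosed, hopen⟩ ⟨0, h0⟩
  exact this.ge (Set.mem_univ t)

/-- The germ of a quotient of entire functions is single valued. -/
theorem isSingleValued_of_smul_eq {z₀ : ℂ} {f : ℂ → ℂ × ℂ} {V : ℂ → ℂ} {W : ℂ → ℂ × ℂ}
    (hV : Differentiable ℂ V) (hW : Differentiable ℂ W) (hV₀ : V z₀ ≠ 0)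
    (h : ∀ᶠ z in 𝓝 z₀, V z • f z = W z) : IsSingleValued f z₀ := by
  intro z₁ γ γ' F F' hF hF'
  have e₁ := hF.eventually_smul_eq hV hW h 1
  have e₂ := hF'.eventually_smul_eq hV hW h 1
  have a₁ := hF.analyticAt 1
  have a₂ := hF'.analyticAt 1
  rw [γ.target] at e₁ a₁
  rw [γ'.target] at e₂ a₂
  -- `V` is not identically zero, so its zeros are isolated and it can be cancelled near `z₁`.
  have hne : ∀ᶠ z in 𝓝[≠] z₁, V z ≠ 0 := by
    refine (hV.analyticAt z₁).eventually_eq_zero_or_eventually_ne_zero.resolve_left fun h0 => hV₀ ?_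
    have hVan : AnalyticOnNhd ℂ V Set.univ := fun z _ => hV.analyticAt z
    exact hVan.eqOn_zero_of_preconnected_of_eventuallyEq_zero isPreconnected_univ
      (Set.mem_univ z₁) h0 (Set.mem_univ z₀)
  refine (a₁.frequently_eq_iff_eventually_eq a₂).1 (Eventually.frequently ?_)
  filter_upwards [hne, e₁.filter_mono nhdsWithin_le_nhds, e₂.filter_mono nhdsWithin_le_nhds]
    with z hz h₁ h₂
  exact smul_right_injective _ hz (h₁.trans h₂.symm)

/-! ### Linear differential equations -/

/-- A local holomorphic function with vanishing derivative is locally constant. -/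
theorem eventually_eq_of_hasDerivAt_zero {E : Type*} [NormedAddCommGroup E] [NormedSpace ℂ E]
    {g : ℂ → E} {z₀ : ℂ} (h : ∀ᶠ z in 𝓝 z₀, HasDerivAt g 0 z) :
    ∀ᶠ z in 𝓝 z₀, g z = g z₀ := by
  obtain ⟨r, hr, hball⟩ := Metric.eventually_nhds_iff_ball.1 h
  filter_upwards [Metric.ball_mem_nhds _ hr] with z hz
  refine (convex_ball z₀ r).is_const_of_fderivWithin_eq_zero (𝕜 := ℂ) (f := g)
    (fun w hw => (hball w hw).differentiableAt.differentiableWithinAt) (fun w hw => ?_)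
    hz (Metric.mem_ball_self hr)
  rw [fderivWithin_of_isOpen Metric.isOpen_ball hw]
  simpa using (hball w hw).hasFDerivAt.fderiv

/-- Local solutions of linear autonomous systems are entire. -/
theorem exists_differentiable_of_linear_ode {E : Type*} [NormedAddCommGroup E] [NormedSpace ℂ E]
    [CompleteSpace E] (A : E →L[ℂ] E) {y : ℂ → E} {z₀ : ℂ}
    (h : ∀ᶠ z in 𝓝 z₀, HasDerivAt y (A (y z)) z) :
    ∃ Y : ℂ → E, Differentiable ℂ Y ∧ ∀ᶠ z in 𝓝 z₀, y z = Y z := by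
  have hg : ∀ᶠ z in 𝓝 z₀,
      HasDerivAt (fun z : ℂ => NormedSpace.exp (z • (-A)) (y z)) 0 z := by
    filter_upwards [h] with z hz
    convert! (hasDerivAt_exp_smul_const (𝕂 := ℂ) (-A) z).clm_apply hz using 1
    simp
  have hconst := eventually_eq_of_hasDerivAt_zero hg
  refine ⟨fun z => NormedSpace.exp (z • A) (NormedSpace.exp (z₀ • (-A)) (y z₀)), fun z => ?_, ?_⟩
  · exact ((hasDerivAt_exp_smul_const (𝕂 := ℂ) A z).differentiableAt).clm_apply
      (differentiableAt_const _)
  · filter_upwards [hconst] with z hz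
    rw [← hz, ← mul_apply_eq_comp, smul_neg, ← NormedSpace.exp_add_of_commute_of_mem_ball (𝕂 := ℂ)]
    · simp
    · exact (Commute.refl _).neg_right
    · simp [NormedSpace.expSeries_radius_eq_top]
    · simp [NormedSpace.expSeries_radius_eq_top]

/-! ### Inverse functions and a criterion for multivaluedness -/

/-- Holomorphic inverse function theorem in one variable. -/
theorem exists_analyticAt_localInverse {Z : ℂ → ℂ} {s : ℂ} (hZ : AnalyticAt ℂ Z s)
    (hd : deriv Z s ≠ 0) :
    ∃ σ : ℂ → ℂ, AnalyticAt ℂ σ (Z s) ∧ σ (Z s) = s ∧ (∀ᶠ w in 𝓝 s, σ (Z w) = w) ∧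
      ∀ᶠ z in 𝓝 (Z s), Z (σ z) = z := by
  have hs : HasStrictDerivAt Z (deriv Z s) s := hZ.hasStrictDerivAt
  have hs' := hs.hasStrictFDerivAt_equiv hd
  exact ⟨hs.localInverse Z _ s hd, hZ.analyticAt_localInverse hd, hs'.localInverse_apply_image,
    hs'.eventually_left_inverse, hs'.eventually_right_inverse⟩

theorem eventuallyEq_of_left_inverse {Z σ σ' : ℂ → ℂ} {s : ℂ} (hZ : AnalyticAt ℂ Z s)
    (hd : deriv Z s ≠ 0) (h : ∀ᶠ w in 𝓝 s, σ (Z w) = w) (h' : ∀ᶠ w in 𝓝 s, σ' (Z w) = w) :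
    σ =ᶠ[𝓝 (Z s)] σ' := by
  rw [← hZ.hasStrictDerivAt.map_nhds_eq hd]
  change ∀ᶠ w in 𝓝 s, σ (Z w) = σ' (Z w)
  filter_upwards [h, h'] with w hw hw'
  rw [hw, hw']

/-- If `Z` is locally invertible on a convex open set and identifies two points that `Φ`
separates, then the germ of `Φ ∘ Z⁻¹` is not single valued. -/
theorem not_isSingleValued_comp_inverse {U : Set ℂ} (hU : Convex ℝ U)
    {Z : ℂ → ℂ} {Φ : ℂ → ℂ × ℂ} (hZ : ∀ s ∈ U, AnalyticAt ℂ Z s) (hd : ∀ s ∈ U, deriv Z s ≠ 0)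
    (hΦ : ∀ s ∈ U, AnalyticAt ℂ Φ s) {s₀ s₁ : ℂ} (h₀ : s₀ ∈ U) (h₁ : s₁ ∈ U)
    (hZs : Z s₀ = Z s₁) (hne : Φ s₀ ≠ Φ s₁) {σ : ℂ → ℂ}
    (hσa : AnalyticAt ℂ σ (Z s₀)) (hσ : ∀ᶠ w in 𝓝 s₀, σ (Z w) = w) :
    ¬ IsSingleValued (Φ ∘ σ) (Z s₀) := by
  intro hsv
  set p : unitInterval → ℂ := fun t => AffineMap.lineMap s₀ s₁ (t : ℝ) with hp
  have hpc : Continuous p := AffineMap.lineMap_continuous.comp continuous_subtype_val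
  have hp0 : p 0 = s₀ := by simp [hp]
  have hp1 : p 1 = s₁ := by simp [hp]
  have hpU : ∀ t, p t ∈ U := fun t => hU.lineMap_mem h₀ h₁ t.2
  choose τ hτa hτs hτl _ using fun t => exists_analyticAt_localInverse (hZ _ (hpU t)) (hd _ (hpU t))
  let γ : Path (Z s₀) (Z s₁) :=
    { toFun := fun t => Z (p t)
      continuous_toFun := continuous_iff_continuousAt.2 fun t =>
        (hZ _ (hpU t)).continuousAt.comp hpc.continuousAt
      source' := by rw [hp0]
      target' := by rw [hp1] }
  -- The image of the segment under `Z` is a loop; it is compared with the constant path.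
  let γ' : Path (Z s₀) (Z s₁) := (Path.refl (Z s₀)).cast rfl hZs.symm
  have hσs : σ (Z s₀) = s₀ := hσ.self_of_nhds
  have hF : IsAnalyticContinuationAlong (Φ ∘ σ) γ (fun t => Φ ∘ τ t) := by
    refine ⟨fun t => ?_, ?_, fun t => ?_⟩
    · exact AnalyticAt.comp (by change AnalyticAt ℂ Φ (τ t (Z (p t))); rw [hτs]; exact hΦ _ (hpU t)) (hτa t)
    · have hl := hτl 0
      rw [hp0] at hl
      exact (eventuallyEq_of_left_inverse (hZ _ h₀) (hd _ h₀) hl hσ).fun_comp Φ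
    · filter_upwards [hpc.continuousAt.eventually (hτl t).eventually_nhds] with s hs
      exact (eventuallyEq_of_left_inverse (hZ _ (hpU s)) (hd _ (hpU s)) (hτl s) hs).fun_comp Φ
  have hF' : IsAnalyticContinuationAlong (Φ ∘ σ) γ' (fun _ => Φ ∘ σ) := by
    refine ⟨fun t => ?_, EventuallyEq.rfl, fun t => Eventually.of_forall fun s => EventuallyEq.rfl⟩
    exact AnalyticAt.comp (by change AnalyticAt ℂ Φ (σ (Z s₀)); rw [hσs]; exact hΦ _ h₀) hσa
  have hfin := (hsv (Z s₁) γ γ' _ _ hF hF').self_of_nhds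
  have h1 := hτs 1
  rw [hp1] at h1
  simp only [Function.comp_apply, h1] at hfin
  rw [← hZs, hσs] at hfin
  exact hne hfin.symm

/-! ### The system and its single-valued cases -/

/-- The right side is, up to sign, the characteristic polynomial of the lower block at `a`, with
roots `J₂` and `J₃`. -/
theorem principal_moment_eq_iff {a b c d : ℝ} :
    (J₁ a = J₂ b c d ∨ J₁ a = J₃ b c d) ↔ d ^ 2 - (b - a) * (c - a) = 0 := by
  unfold J₁ J₂ J₃
  have hs := Real.sq_sqrt (show 0 ≤ (b - c) ^ 2 + 4 * d ^ 2 by positivity)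
  set r := Real.sqrt ((b - c) ^ 2 + 4 * d ^ 2)
  have key : (2 * a - (b + c) - r) * (2 * a - (b + c) + r) =
      -4 * (d ^ 2 - (b - a) * (c - a)) := by linear_combination -hs
  constructor
  · rintro (h | h)
    · have : 2 * a - (b + c) - r = 0 := by linarith
      rw [this] at key
      linarith
    · have : 2 * a - (b + c) + r = 0 := by linarith
      rw [this] at key
      linarith
  · intro h
    rw [h, mul_zero, mul_eq_zero] at key
    rcases key with h | h
    · left; linarith
    · right; linarith

/-- The system for the two components of a solution, in solved form. -/
theorem IsSolutionNear.eventually_hasDerivAt {a b c d : ℝ} (ha : a ≠ 0) (hb : b ≠ 0)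
    {ω : ℂ → ℂ × ℂ} {z₀ : ℂ} (h : IsSolutionNear a b c d ω z₀) :
    ∀ᶠ z in 𝓝 z₀,
      HasDerivAt (fun z => (ω z).1) ((-(d : ℂ) * (ω z).2 ^ 2 + (ω z).2 * (b - c) + d) / a) z ∧
      HasDerivAt (fun z => (ω z).2) ((ω z).1 * (d * (ω z).2 + (c - a)) / b) z := by
  have ha' : (a : ℂ) ≠ 0 := by exact_mod_cast ha
  have hb' : (b : ℂ) ≠ 0 := by exact_mod_cast hb
  filter_upwards [h] with z ⟨hz, h₁, h₂⟩
  rw [J₁] at h₁ h₂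
  constructor
  · convert! (ContinuousLinearMap.fst ℂ ℂ ℂ).hasFDerivAt.comp_hasDerivAt z hz.hasDerivAt using 1
    rw [ContinuousLinearMap.coe_fst']
    rw [← h₁]; field_simp
  · convert! (ContinuousLinearMap.snd ℂ ℂ ℂ).hasFDerivAt.comp_hasDerivAt z hz.hasDerivAt using 1
    rw [ContinuousLinearMap.coe_snd']
    rw [← h₂]; field_simp

theorem isSingleValued_of_product_inertia_eq_zero {a b c : ℝ} (ha : a ≠ 0) (hb : b ≠ 0)
    {ω : ℂ → ℂ × ℂ} {z₀ : ℂ} (h : IsSolutionNear a b c 0 ω z₀) : IsSingleValued ω z₀ := by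
  let A : ℂ × ℂ →L[ℂ] ℂ × ℂ :=
    (((b - c) / a : ℂ) • ContinuousLinearMap.snd ℂ ℂ ℂ).prod
      (((c - a) / b : ℂ) • ContinuousLinearMap.fst ℂ ℂ ℂ)
  have hA : ∀ᶠ z in 𝓝 z₀, HasDerivAt ω (A (ω z)) z := by
    filter_upwards [h.eventually_hasDerivAt ha hb] with z ⟨h₁, h₂⟩
    convert! h₁.prodMk h₂ using 1
    simp only [A, ContinuousLinearMap.prod_apply, smul_apply,
      ContinuousLinearMap.coe_snd', ContinuousLinearMap.coe_fst', smul_eq_mul, Prod.mk.injEq,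
      Complex.ofReal_zero]
    constructor <;> ring
  obtain ⟨Y, hY, hω⟩ := exists_differentiable_of_linear_ode A hA
  refine isSingleValued_of_smul_eq (V := fun _ => 1) (differentiable_const _) hY one_ne_zero ?_
  simpa using hω

/-- A solution of a linear homogeneous equation `u' = p u` that vanishes at a point vanishes
near that point. -/
theorem eventually_eq_zero_of_linear {p u : ℂ → ℂ} {z₀ : ℂ}
    (hp : ∀ᶠ z in 𝓝 z₀, DifferentiableAt ℂ p z)
    (hu : ∀ᶠ z in 𝓝 z₀, HasDerivAt u (p z * u z) z) (h₀ : u z₀ = 0) :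
    ∀ᶠ z in 𝓝 z₀, u z = 0 := by
  obtain ⟨r, hr, hball⟩ := Metric.eventually_nhds_iff_ball.1 hp
  have hpd : DifferentiableOn ℂ p (Metric.ball z₀ r) :=
    fun z hz => (hball z hz).differentiableWithinAt
  obtain ⟨P, hP⟩ := hpd.isExactOn_ball
  have hg : ∀ᶠ z in 𝓝 z₀, HasDerivAt (fun z => Complex.exp (-P z) * u z) 0 z := by
    filter_upwards [hu, Metric.ball_mem_nhds z₀ hr] with z hz hzr
    convert! (hP z hzr).neg.cexp.mul hz using 1
    ring
  filter_upwards [eventually_eq_of_hasDerivAt_zero hg] with z hz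
  simpa [h₀, Complex.exp_ne_zero] using hz

theorem isSingleValued_of_principal_moment_eq {a b c d : ℝ} (ha : a ≠ 0) (hb : b ≠ 0)
    (hd : d ≠ 0) (hm : d ^ 2 - (b - a) * (c - a) = 0)
    {ω : ℂ → ℂ × ℂ} {z₀ : ℂ} (h : IsSolutionNear a b c d ω z₀) : IsSingleValued ω z₀ := by
  have ha' : (a : ℂ) ≠ 0 := by exact_mod_cast ha
  have hb' : (b : ℂ) ≠ 0 := by exact_mod_cast hb
  have hd' : (d : ℂ) ≠ 0 := by exact_mod_cast hd
  have hm' : (d : ℂ) ^ 2 - (b - a) * (c - a) = 0 := by exact_mod_cast hm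
  set x : ℂ → ℂ := fun z => (ω z).1 with hx
  -- The shift makes `u = 0` invariant; the constant term `m/d` it leaves in `a x'` vanishes by
  -- `hm`.
  set u : ℂ → ℂ := fun z => (ω z).2 + (c - a) / d with hu
  have hxu : ∀ᶠ z in 𝓝 z₀,
      HasDerivAt x ((-d * u z + (b + c - 2 * a)) * u z / a) z ∧
      HasDerivAt u (d / b * x z * u z) z := by
    filter_upwards [h.eventually_hasDerivAt ha hb] with z ⟨h₁, h₂⟩
    constructor
    · convert! h₁ using 1
      simp only [hu]
      field_simp
      linear_combination -hm'
    · convert! h₂.add_const ((c - a : ℂ) / d) using 1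
      simp only [hu, hx]
      field_simp
  have hω : ∀ z, ω z = (x z, u z - (c - a) / d) := fun z => by simp [hx, hu]
  by_cases hu₀ : u z₀ = 0
  · have hu0 : ∀ᶠ z in 𝓝 z₀, u z = 0 :=
      eventually_eq_zero_of_linear (p := fun z => d / b * x z)
        (hxu.mono fun z hz => hz.1.differentiableAt.const_mul _) (hxu.mono fun z hz => hz.2) hu₀
    have hx0 : ∀ᶠ z in 𝓝 z₀, x z = x z₀ := by
      refine eventually_eq_of_hasDerivAt_zero ?_
      filter_upwards [hxu, hu0] with z hz hz'
      simpa [hz'] using hz.1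
    refine isSingleValued_of_smul_eq (V := fun _ => 1) (W := fun _ => ω z₀)
      (differentiable_const _) (differentiable_const _) one_ne_zero ?_
    filter_upwards [hu0, hx0] with z h₁ h₂
    rw [one_smul, hω, hω z₀, h₁, h₂, hu₀]
  · have hune : ∀ᶠ z in 𝓝 z₀, u z ≠ 0 :=
      hxu.self_of_nhds.2.continuousAt.eventually_ne hu₀
    set e : ℂ := b + c - 2 * a with he
    -- The energy integral, free of logarithms here; it removes `x²/u` from the derivative of `x/u`.
    set E : ℂ → ℂ := fun z => a / b * x z ^ 2 + u z ^ 2 - 2 * e / d * u z with hE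
    have hEc : ∀ᶠ z in 𝓝 z₀, E z = E z₀ := by
      refine eventually_eq_of_hasDerivAt_zero ?_
      filter_upwards [hxu] with z ⟨h₁, h₂⟩
      convert! (((h₁.pow 2).const_mul (a / b : ℂ)).add (h₂.pow 2)).sub
        (h₂.const_mul (2 * e / d)) using 1
      field_simp
      ring
    let A : ℂ × ℂ × ℂ →L[ℂ] ℂ × ℂ × ℂ :=
      let π₁ := ContinuousLinearMap.fst ℂ ℂ (ℂ × ℂ)
      let π₂ := ContinuousLinearMap.fst ℂ ℂ ℂ ∘L ContinuousLinearMap.snd ℂ ℂ (ℂ × ℂ)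
      let π₃ := ContinuousLinearMap.snd ℂ ℂ ℂ ∘L ContinuousLinearMap.snd ℂ ℂ (ℂ × ℂ)
      ((-(d / b : ℂ)) • π₂).prod
        (((-(E z₀ / a) * d : ℂ) • π₁ - (e / a) • π₃).prod 0)
    -- the vector `(1 / u, x / u, 1)` satisfies a linear system
    have hA : ∀ᶠ z in 𝓝 z₀, HasDerivAt (fun z => ((u z)⁻¹, x z * (u z)⁻¹, (1 : ℂ)))
        (A ((u z)⁻¹, x z * (u z)⁻¹, (1 : ℂ))) z := by
      filter_upwards [hxu, hune, hEc] with z ⟨h₁, h₂⟩ hz hEz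
      convert! (h₂.inv hz).prodMk ((h₁.mul (h₂.inv hz)).prodMk (hasDerivAt_const z (1 : ℂ))) using 1
      simp only [A, ContinuousLinearMap.prod_apply, smul_apply,
        sub_apply, ContinuousLinearMap.comp_apply,
        ContinuousLinearMap.coe_snd', ContinuousLinearMap.coe_fst', smul_eq_mul, Prod.mk.injEq,
        zero_apply, Pi.inv_apply, and_true]
      constructor
      · field_simp
      · rw [← hEz, hE]
        field_simp
        ring
    obtain ⟨Y, hY, hYe⟩ := exists_differentiable_of_linear_ode A hA
    refine isSingleValued_of_smul_eq (V := fun z => (Y z).1)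
      (W := fun z => ((Y z).2.1, 1 - (c - a) / d * (Y z).1)) hY.fst
      (hY.snd.fst.prodMk ((differentiable_const _).sub (hY.fst.const_mul _))) ?_ ?_
    · rw [← hYe.self_of_nhds]
      exact inv_ne_zero hu₀
    · filter_upwards [hYe, hune] with z hz hz'
      rw [← hz, hω]
      simp only [Prod.smul_mk, smul_eq_mul, Prod.mk.injEq]
      constructor
      · ring
      · field_simp

/-! ### Non-injectivity of perturbations of `exp` -/

/-- A function on a large disc whose derivative is close to that of `exp` is not injective. -/
theorem exists_ne_eq_of_deriv_near_exp {H g : ℂ → ℂ}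
    (hH : ∀ s ∈ Metric.ball (0 : ℂ) 10, HasDerivAt H (g s) s)
    (hg : ∀ s ∈ Metric.ball (0 : ℂ) 10, ‖g s - Complex.exp s‖ ≤ 1 / 1000) :
    ∃ s₀ ∈ Metric.ball (0 : ℂ) 10, ∃ s₁ ∈ Metric.ball (0 : ℂ) 10, s₀ ≠ s₁ ∧ H s₀ = H s₁ := by
  have hk : ∀ s ∈ Metric.ball (0 : ℂ) 10, ∀ t ∈ Metric.ball (0 : ℂ) 10,
      ‖(H t - Complex.exp t) - (H s - Complex.exp s)‖ ≤ 1 / 50 := by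
    intro s hs t ht
    have hlip := (convex_ball (0 : ℂ) 10).norm_image_sub_le_of_norm_hasDerivWithin_le
      (f := fun s => H s - Complex.exp s) (f' := fun s => g s - Complex.exp s)
      (fun w hw => ((hH w hw).sub (Complex.hasDerivAt_exp w)).hasDerivWithinAt) hg hs ht
    rw [mem_ball_zero_iff] at hs ht
    have := norm_sub_le t s
    linarith
  set p : ℂ := Real.pi * Complex.I with hp
  have hpn : ‖p‖ ≤ 4 := by
    simp [hp, abs_of_pos Real.pi_pos, Real.pi_le_four]
  have hpb : p ∈ Metric.ball (0 : ℂ) 10 := by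
    rw [mem_ball_zero_iff]; linarith
  have hnpb : -p ∈ Metric.ball (0 : ℂ) 10 := by
    rw [mem_ball_zero_iff, norm_neg]; linarith
  have hsub : Metric.closedBall p (1 / 2) ⊆ Metric.ball 0 10 := fun z hz => by
    rw [mem_closedBall_iff_norm] at hz
    rw [mem_ball_zero_iff]
    have := norm_add_le (z - p) p
    rw [sub_add_cancel] at this
    linarith
  have hexp : Complex.exp p = -1 := Complex.exp_pi_mul_I
  have hexp' : Complex.exp (-p) = -1 := by rw [Complex.exp_neg, hexp]; norm_num
  -- Near `p = πi`, `exp` moves points by at least `1/2 - 1/4` on this circle; the perturbation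
  -- costs `1/50`.
  have hsphere : ∀ z ∈ Metric.sphere p (1 / 2), (1 : ℝ) / 5 ≤ ‖H z - H p‖ := by
    intro z hz
    have h₁ := hk p hpb z (hsub (Metric.sphere_subset_closedBall hz))
    rw [mem_sphere_iff_norm] at hz
    have h₂ := Complex.norm_exp_sub_one_sub_id_le (x := z - p) (by rw [hz]; norm_num)
    rw [hz, Complex.exp_sub, hexp] at h₂
    have h₃ : z - p = (H z - Complex.exp z - (H p - Complex.exp p)) - (H z - H p) -
        (Complex.exp z / -1 - 1 - (z - p)) := by rw [hexp]; ring
    have h₄ := norm_sub_le ((H z - Complex.exp z - (H p - Complex.exp p)) - (H z - H p))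
      (Complex.exp z / -1 - 1 - (z - p))
    have h₅ := norm_sub_le (H z - Complex.exp z - (H p - Complex.exp p)) (H z - H p)
    rw [← h₃, hz] at h₄
    linarith
  have hdiff : DifferentiableOn ℂ H (Metric.closedBall p (1 / 2)) :=
    fun z hz => (hH z (hsub hz)).differentiableAt.differentiableWithinAt
  have hfreq : ∃ᶠ z in 𝓝 p, H z ≠ H p := by
    have hgp : g p ≠ 0 := by
      intro h0
      have := hg p hpb
      rw [h0, hexp] at this
      norm_num at this
    exact (((hH p hpb).eventually_ne hgp (c := H p)).frequently).filter_mono nhdsWithin_le_nhds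
  -- Quantitative open mapping: the small disc about `p` already covers `H (-p)`, while `-p` is `2π`
  -- away.
  have himage := (hdiff.diffContOnCl_ball Set.Subset.rfl).ball_subset_image_closedBall
    (by norm_num) hsphere hfreq
  have hmem : H (-p) ∈ Metric.ball (H p) (1 / 5 / 2) := by
    have := hk p hpb (-p) hnpb
    rw [hexp, hexp'] at this
    rw [mem_ball_iff_norm]
    have h2 : H (-p) - H p = H (-p) - -1 - (H p - -1) := by ring
    rw [h2]
    linarith
  obtain ⟨s, hs, hsH⟩ := himage hmem
  refine ⟨-p, hnpb, s, hsub hs, ?_, hsH.symm⟩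
  rintro rfl
  rw [mem_closedBall_iff_norm, show -p - p = -(2 * p) by ring, norm_neg, norm_mul] at hs
  have : ‖p‖ = Real.pi := by simp [hp, abs_of_pos Real.pi_pos]
  rw [this] at hs
  have := Real.pi_gt_three
  norm_num at hs
  linarith

/-- The inverse of the square root of a number close to `1` is close to `1`. -/
theorem norm_sqrt_inv_sub_one_le {P S : ℂ} (hS : S ^ 2 = P) (hre : 0 < S.re) {δ : ℝ}
    (hδ : δ ≤ 1 / 2) (hP : ‖P - 1‖ ≤ δ) : ‖S⁻¹ - 1‖ ≤ 2 * δ := by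
  have h1 : 1 ≤ ‖S + 1‖ := by
    have := Complex.re_le_norm (S + 1)
    simp at this
    linarith
  have h2 : ‖S - 1‖ ≤ δ := by
    have : P - 1 = (S - 1) * (S + 1) := by rw [← hS]; ring
    rw [this, norm_mul] at hP
    nlinarith [norm_nonneg (S - 1)]
  have hS0 : S ≠ 0 := by rintro rfl; simp at hre
  have h3 : 1 / 2 ≤ ‖S‖ := by
    have := norm_sub_le S (S - 1)
    rw [sub_sub_cancel, norm_one] at this
    linarith
  have h4 : S⁻¹ - 1 = -(S - 1) / S := by field_simp; ring
  rw [h4, norm_div, norm_neg, div_le_iff₀ (by linarith)]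
  nlinarith [norm_nonneg (S - 1)]

/-! ### A multivalued solution on a special energy level -/

/-- The right-hand side of the energy equation: with `u = exp (-ζ) / ε`, a suitable level of the
energy integral reads `x ^ 2 = (b * κ / (d * ε)) ^ 2 * radicand * exp (-2 * ζ)`. -/
noncomputable def radicand (A B ε ζ : ℂ) : ℂ :=
  1 - A * ε * Complex.exp ζ + B * ε ^ 2 * ζ * Complex.exp ζ ^ 2

/-- The tolerance is fixed by later losses: a factor `2` from the inverse square root and `exp 10`
from `‖exp ζ‖` leave `1/1000`. -/
theorem exists_norm_radicand_sub_one_le (A B : ℂ) :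
    ∃ ε : ℝ, 0 < ε ∧ ∀ ζ ∈ Metric.ball (0 : ℂ) 10, ‖radicand A B ε ζ - 1‖ ≤
      1 / (2000 * Real.exp 10) := by
  set K : ℝ := ‖A‖ * Real.exp 10 + ‖B‖ * 10 * Real.exp 10 ^ 2 + 1 with hK
  have hKpos : 0 < K := by positivity
  have hexp : 1 ≤ Real.exp 10 := Real.one_le_exp (by norm_num)
  set η : ℝ := 1 / (2000 * Real.exp 10) with hη
  have hηpos : 0 < η := by positivity
  refine ⟨min 1 (η / K), by positivity, fun ζ hζ => ?_⟩
  set ε := min 1 (η / K) with hε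
  have hε0 : 0 < ε := by positivity
  have hε1 : ε ≤ 1 := min_le_left _ _
  have hεK : ε * K ≤ η := by
    rw [← le_div_iff₀ hKpos]; exact min_le_right _ _
  rw [mem_ball_zero_iff] at hζ
  have hnexp : ‖Complex.exp ζ‖ ≤ Real.exp 10 := by
    rw [Complex.norm_exp]
    exact Real.exp_le_exp.2 ((Complex.re_le_norm ζ).trans hζ.le)
  have hsum : radicand A B ε ζ - 1 =
      -(A * ε * Complex.exp ζ) + B * ε ^ 2 * ζ * Complex.exp ζ ^ 2 := by unfold radicand; ring
  rw [hsum]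
  have hεn : ‖(ε : ℂ)‖ = ε := by rw [Complex.norm_real, Real.norm_of_nonneg hε0.le]
  calc _ ≤ ‖-(A * ε * Complex.exp ζ)‖ + ‖B * ε ^ 2 * ζ * Complex.exp ζ ^ 2‖ := norm_add_le _ _
    _ = ‖A‖ * ε * ‖Complex.exp ζ‖ + ‖B‖ * ε ^ 2 * ‖ζ‖ * ‖Complex.exp ζ‖ ^ 2 := by
      simp only [norm_neg, norm_mul, norm_pow, hεn]
    _ ≤ ‖A‖ * ε * Real.exp 10 + ‖B‖ * (ε * 1) * 10 * Real.exp 10 ^ 2 := by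
      rw [sq ε]
      gcongr
    _ ≤ ε * K := by rw [hK]; nlinarith
    _ ≤ η := hεK

theorem hasDerivAt_radicand (A B ε ζ : ℂ) :
    HasDerivAt (radicand A B ε) (-A * ε * Complex.exp ζ +
      B * ε ^ 2 * (1 + 2 * ζ) * Complex.exp ζ ^ 2) ζ := by
  have he := Complex.hasDerivAt_exp ζ
  unfold radicand
  convert! ((he.const_mul (A * ε)).const_sub 1).add
    (((hasDerivAt_id ζ).const_mul (B * ε ^ 2)).mul (he.pow 2)) using 1
  simp
  ring

/-- `exp (-ζ) / ε` and the square root of the radicand determine `ζ`. -/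
theorem eq_of_radicand_eq {A B ε ζ ζ' : ℂ} (hB : B ≠ 0) (hε : ε ≠ 0)
    (he : Complex.exp ζ = Complex.exp ζ') (h : radicand A B ε ζ = radicand A B ε ζ') : ζ = ζ' := by
  unfold radicand at h
  rw [he] at h
  have : B * ε ^ 2 * Complex.exp ζ' ^ 2 * (ζ - ζ') = 0 := by linear_combination h
  simpa [hB, hε, Complex.exp_ne_zero, sub_eq_zero] using this

/-- If the inertia tensor is not of the exceptional form, some solution is not single valued. -/
theorem exists_solution_not_isSingleValued {a b c d : ℝ} (ha : a ≠ 0) (hb : b ≠ 0)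
    (hd : d ≠ 0) (hm : d ^ 2 - (b - a) * (c - a) ≠ 0) :
    ∃ (z₀ : ℂ) (ω : ℂ → ℂ × ℂ), IsSolutionNear a b c d ω z₀ ∧ ¬ IsSingleValued ω z₀ := by
  have ha' : (a : ℂ) ≠ 0 := by exact_mod_cast ha
  have hb' : (b : ℂ) ≠ 0 := by exact_mod_cast hb
  have hd' : (d : ℂ) ≠ 0 := by exact_mod_cast hd
  set m : ℂ := (d : ℂ) ^ 2 - (b - a) * (c - a) with hmdef
  have hm' : m ≠ 0 := by rw [hmdef]; exact_mod_cast hm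
  set e : ℂ := b + c - 2 * a with he
  set A : ℂ := 2 * e / d with hA
  set B : ℂ := 2 * m / d ^ 2 with hB
  have hB0 : B ≠ 0 := div_ne_zero (mul_ne_zero two_ne_zero hm') (pow_ne_zero 2 hd')
  -- Chosen so that `(b κ / d)² = -b/a`, the coefficient of `u²` when the energy relation is solved
  -- for `x²`.
  obtain ⟨κ, hκ⟩ : ∃ κ : ℂ, κ ^ 2 = -d ^ 2 / (a * b) := IsAlgClosed.exists_pow_nat_eq _ two_pos
  have hκ0 : κ ≠ 0 := by
    rintro rfl
    have : (-d ^ 2 / (a * b) : ℂ) ≠ 0 :=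
      div_ne_zero (neg_ne_zero.2 (pow_ne_zero 2 hd')) (mul_ne_zero ha' hb')
    exact this (by rw [← hκ]; ring)
  obtain ⟨ε, hε, hP⟩ := exists_norm_radicand_sub_one_le A B
  have hε0 : (ε : ℂ) ≠ 0 := by exact_mod_cast hε.ne'
  set U := Metric.ball (0 : ℂ) 10 with hU
  set P := radicand A B ε with hPdef
  -- The branch of `√P` with positive real part, available since `P` stays near `1`.
  set S : ℂ → ℂ := fun ζ => Complex.exp (Complex.log (P ζ) / 2) with hS
  have hexp10 : 1 ≤ Real.exp 10 := Real.one_le_exp (by norm_num)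
  have hη : 1 / (2000 * Real.exp 10) ≤ 1 / 2 := by
    gcongr
    linarith
  have hslit : ∀ ζ ∈ U, P ζ ∈ Complex.slitPlane := fun ζ hζ => by
    left
    have h1 := (Complex.abs_re_le_norm _).trans ((hP ζ hζ).trans hη)
    rw [abs_le] at h1
    simp at h1
    linarith
  have hS2 : ∀ ζ ∈ U, S ζ ^ 2 = P ζ := fun ζ hζ => by
    rw [hS, ← Complex.exp_nat_mul]
    rw [show ((2 : ℕ) : ℂ) * (Complex.log (P ζ) / 2) = Complex.log (P ζ) by push_cast; ring]
    exact Complex.exp_log (Complex.slitPlane_ne_zero (hslit ζ hζ))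
  have hS0 : ∀ ζ, S ζ ≠ 0 := fun ζ => Complex.exp_ne_zero _
  have hSre : ∀ ζ ∈ U, 0 < (S ζ).re := fun ζ hζ => by
    rw [hS]
    simp only [Complex.exp_re]
    refine mul_pos (Real.exp_pos _) (Real.cos_pos_of_mem_Ioo ?_)
    have h1 := Complex.neg_pi_lt_arg (P ζ)
    have h2 := (Complex.arg_le_pi (P ζ)).lt_of_ne (Complex.mem_slitPlane_iff_arg.1 (hslit ζ hζ)).1
    rw [Complex.div_ofNat_im, Complex.log_im]
    constructor <;> linarith
  have hSd : ∀ ζ ∈ U, HasDerivAt S ((-A * ε * Complex.exp ζ +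
      B * ε ^ 2 * (1 + 2 * ζ) * Complex.exp ζ ^ 2) / (2 * S ζ)) ζ := fun ζ hζ => by
    have := (((hasDerivAt_radicand A B ε ζ).clog (hslit ζ hζ)).div_const 2).cexp
    convert! this using 1
    change _ = S ζ * _
    rw [← hPdef, ← hS2 ζ hζ]
    have := hS0 ζ
    field_simp
  have hSdiff : DifferentiableOn ℂ S U := fun ζ hζ =>
    (hSd ζ hζ).differentiableAt.differentiableWithinAt
  set g : ℂ → ℂ := fun ζ => Complex.exp ζ * (S ζ)⁻¹ with hg
  have hgdiff : DifferentiableOn ℂ g U :=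
    Complex.differentiable_exp.differentiableOn.mul (hSdiff.inv fun ζ _ => hS0 ζ)
  obtain ⟨H, hH⟩ := hgdiff.isExactOn_ball
  have hgexp : ∀ ζ ∈ U, ‖g ζ - Complex.exp ζ‖ ≤ 1 / 1000 := fun ζ hζ => by
    have h1 := norm_sqrt_inv_sub_one_le (hS2 ζ hζ) (hSre ζ hζ) hη (hP ζ hζ)
    have h2 : ‖Complex.exp ζ‖ ≤ Real.exp 10 := by
      rw [Complex.norm_exp]
      refine Real.exp_le_exp.2 ((Complex.re_le_norm ζ).trans ?_)
      rw [hU, mem_ball_zero_iff] at hζ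
      exact hζ.le
    calc ‖g ζ - Complex.exp ζ‖ = ‖Complex.exp ζ‖ * ‖(S ζ)⁻¹ - 1‖ := by
          rw [← norm_mul]; congr 1; simp only [hg]; ring
      _ ≤ Real.exp 10 * (2 * (1 / (2000 * Real.exp 10))) := by gcongr
      _ = 1 / 1000 := by field_simp; norm_num
  obtain ⟨s₀, hs₀, s₁, hs₁, hne, hHs⟩ := exists_ne_eq_of_deriv_near_exp hH hgexp
  -- Time as a function of `ζ`: `u' = (d/b) x u` becomes `dz/dζ = -(ε/κ) exp ζ / S`.
  set Z : ℂ → ℂ := fun ζ => -(ε / κ) * H ζ with hZ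
  have hZd : ∀ ζ ∈ U, HasDerivAt Z (-(ε / κ) * g ζ) ζ := fun ζ hζ => (hH ζ hζ).const_mul _
  have hg0 : ∀ ζ, g ζ ≠ 0 := fun ζ => mul_ne_zero (Complex.exp_ne_zero _) (inv_ne_zero (hS0 ζ))
  have hZ0 : ∀ ζ ∈ U, deriv Z ζ ≠ 0 := fun ζ hζ => by
    rw [(hZd ζ hζ).deriv]
    exact mul_ne_zero (neg_ne_zero.2 (div_ne_zero hε0 hκ0)) (hg0 ζ)
  have hopen : IsOpen U := Metric.isOpen_ball
  have hZa : ∀ ζ ∈ U, AnalyticAt ℂ Z ζ := fun ζ hζ =>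
    DifferentiableOn.analyticAt (s := U)
      (fun w hw => (hZd w hw).differentiableAt.differentiableWithinAt) (hopen.mem_nhds hζ)
  set X : ℂ → ℂ := fun ζ => b * κ / (d * ε) * (S ζ * Complex.exp (-ζ)) with hX
  set Y : ℂ → ℂ := fun ζ => Complex.exp (-ζ) / ε - (c - a) / d with hY
  have hexpd : ∀ ζ, HasDerivAt (fun ζ : ℂ => Complex.exp (-ζ)) (-Complex.exp (-ζ)) ζ := fun ζ => by
    simpa using (hasDerivAt_neg ζ).cexp
  have hXd := fun ζ hζ => ((hSd ζ hζ).mul (hexpd ζ)).const_mul (b * κ / (d * ε) : ℂ)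
  have hYd := fun ζ => ((hexpd ζ).div_const (ε : ℂ)).sub_const ((c - a) / d : ℂ)
  have hΦa : ∀ ζ ∈ U, AnalyticAt ℂ (fun ζ => (X ζ, Y ζ)) ζ := fun ζ hζ =>
    DifferentiableOn.analyticAt (s := U)
      (fun w hw => ((hXd w hw).prodMk (hYd w)).differentiableAt.differentiableWithinAt)
      (hopen.mem_nhds hζ)
  have hΦne : (X s₀, Y s₀) ≠ (X s₁, Y s₁) := fun heq => by
    rw [Prod.mk.injEq] at heq
    obtain ⟨h1, h2⟩ := heq
    have h3 : Complex.exp (-s₀) = Complex.exp (-s₁) := by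
      simpa [hY, hε0] using h2
    have h4 : S s₀ = S s₁ := by
      simpa [hX, h3, hε0, hκ0, hb', hd', Complex.exp_ne_zero] using h1
    refine hne (eq_of_radicand_eq (A := A) hB0 hε0 ?_ ?_)
    · rw [Complex.exp_neg, Complex.exp_neg] at h3
      exact inv_injective h3
    · rw [← hPdef, ← hS2 _ hs₀, ← hS2 _ hs₁, h4]
  obtain ⟨σ, hσa, hσs, hσl, hσr⟩ := exists_analyticAt_localInverse (hZa _ hs₀) (hZ0 _ hs₀)
  refine ⟨Z s₀, (fun ζ => (X ζ, Y ζ)) ∘ σ, ?_, not_isSingleValued_comp_inverse (convex_ball _ _)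
    hZa hZ0 hΦa hs₀ hs₁ (by simp only [hZ, hHs]) hΦne hσa hσl⟩
  have hσU : ∀ᶠ z in 𝓝 (Z s₀), σ z ∈ U :=
    hσa.continuousAt.eventually_mem (by rw [hσs]; exact hopen.mem_nhds hs₀)
  filter_upwards [hσU, hσr.eventually_nhds, hσa.eventually_analyticAt] with z hzU hzr hza
  have hσd : HasDerivAt σ (-(κ / ε) * (S (σ z) * Complex.exp (-σ z))) z := by
    have h1 := hza.differentiableAt.hasDerivAt
    have h2 := (hZd _ hzU).comp z h1
    have h3 := h2.unique ((hasDerivAt_id z).congr_of_eventuallyEq hzr)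
    convert! h1 using 1
    have := hS0 (σ z)
    have := Complex.exp_ne_zero (σ z)
    simp only [hg] at h3
    rw [Complex.exp_neg]
    field_simp at h3 ⊢
    linear_combination h3
  have hωd := ((hXd _ hzU).comp z hσd).prodMk ((hYd (σ z)).comp z hσd)
  have hωd' : HasDerivAt ((fun ζ => (X ζ, Y ζ)) ∘ σ) _ z := hωd
  refine ⟨hωd'.differentiableAt, ?_, ?_⟩
  · rw [hωd'.deriv]
    have h2 := hS2 _ hzU
    have := hS0 (σ z)
    have := Complex.exp_ne_zero (σ z)
    simp only [Function.comp_apply, J₁, hX, hY, Complex.exp_neg]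
    rw [hPdef, radicand] at h2
    generalize Complex.exp (σ z) = E at *
    generalize S (σ z) = s at *
    field_simp at hκ ⊢
    rw [hκ, h2, hA, hB, hmdef, he]
    field_simp
    ring
  · rw [hωd'.deriv]
    simp only [Function.comp_apply, J₁, hX, hY]
    field_simp
    ring

end Suslov

theorem mainTheorem1 (I₁₁ I₂₂ I₃₃ I₂₃ : ℝ)
    (hI : (Suslov.inertiaTensor I₁₁ I₂₂ I₃₃ I₂₃).PosDef) :
    (∀ (z₀ : ℂ) (ω : ℂ → ℂ × ℂ), Suslov.IsSolutionNear I₁₁ I₂₂ I₃₃ I₂₃ ω z₀ →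
        Suslov.IsSingleValued ω z₀) ↔
      (I₂₃ = 0 ∨ Suslov.J₁ I₁₁ = Suslov.J₂ I₂₂ I₃₃ I₂₃ ∨
        Suslov.J₁ I₁₁ = Suslov.J₃ I₂₂ I₃₃ I₂₃) := by
  have ha : I₁₁ ≠ 0 := by simpa [Suslov.inertiaTensor] using (hI.diag_pos (i := 0)).ne'
  have hb : I₂₂ ≠ 0 := by simpa [Suslov.inertiaTensor] using (hI.diag_pos (i := 1)).ne'
  rw [Suslov.principal_moment_eq_iff]
  constructor
  · intro h
    by_contra! hne
    obtain ⟨z₀, ω, hω, hns⟩ := Suslov.exists_solution_not_isSingleValued ha hb hne.1 hne.2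
    exact hns (h z₀ ω hω)
  · intro h z₀ ω hω
    by_cases hd : I₂₃ = 0
    · subst hd
      exact Suslov.isSingleValued_of_product_inertia_eq_zero ha hb hω
    · exact Suslov.isSingleValued_of_principal_moment_eq ha hb hd (h.resolve_left hd) hω
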